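/- Let $X$ be a compact Hausdorff space and let $\alpha\colon X\to X$ be a continuous map. Let $M_\alpha(X)$ denote the set of regular Borel probability measures on $X$ that are $\alpha$-invariant. A point $x\in X$ is called essential (for $\alpha$) if for every neighborhood $V$ of $x$ there exists $\mu\in M_\alpha(X)$ with $\mu(V)>0$. For $y\in X$ and $n\ge 1$ let $$\delta_{y,n}=\frac1n\bigl(\delta_y+\delta_{\alpha(y)}+\dots+\delta_{\alpha^{n-1}(y)}\bigr)$$ be the empirical measure, where $\delta_z$ is the unit point mass at $z$. Then for every $x\in X$ the following three conditions are equivalent: (a) the point $x$ is essential; (b) for every neighborhood $V$ of $x$ there exists $y\in X$ such that $\displaystyle\liminf_{n\to\infty}\delta_{y,n}(V)>0$; (c) for every neighborhood $V$ of $x$ there exists $y\in X$ such that $\displaystyle\limsup_{n\to\infty}\delta_{y,n}(V)>0$. -/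

import Mathlib

open MeasureTheory Filter Topology

/-- `M_α(X)`: the regular Borel probability measures on `X` that are invariant under `α`. -/
def invariantMeasures {X : Type*} [TopologicalSpace X] [MeasurableSpace X] (α : X → X) :
    Set (Measure X) :=
  {μ | IsProbabilityMeasure μ ∧ μ.Regular ∧ MeasurePreserving α μ μ}

/-- A point `x` is essential for `α` if every neighborhood of `x` has positive measure for some
regular `α`-invariant probability measure. -/
def IsEssentialPoint {X : Type*} [TopologicalSpace X] [MeasurableSpace X] (α : X → X) (x : X) :
    Prop :=
  ∀ V ∈ 𝓝 x, ∃ μ ∈ invariantMeasures α, 0 < μ V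

/-- The empirical measure `δ_{y,n} = (1/n) (δ_y + δ_{α(y)} + ⋯ + δ_{α^{n-1}(y)})`. -/
noncomputable def empiricalMeasure {X : Type*} [MeasurableSpace X] (α : X → X) (y : X) (n : ℕ) :
    Measure X :=
  (n : ENNReal)⁻¹ • ∑ k ∈ Finset.range n, Measure.dirac (α^[k] y)

/-! The step from upper density to an invariant measure is a Krylov–Bogolyubov argument. Shrink the
neighborhood to a closed `K` inside the open set `V`, and take orbit averages along an ultrafilter
of times at which `K` has frequency above some `c > 0`. The limit functional is positive, normalized
and `α`-invariant, so Riesz represents it by a measure; a Urysohn function between `K` and `V`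
forces `μ V > 0`. From `μ V > 0` to positive lower density, no ergodic theorem is needed. If every
lower density were zero, then for `0 < c < μ V` each point would have a time at which its visit
frequency is at most `c`. Cutting orbits at such times and integrating gives `μ V ≤ c`, a
contradiction. -/

/-- A bounded orbit average has a limit along every ultrafilter. -/
lemma exists_tendsto_birkhoffAverage_ultrafilter {X : Type*} (α : X → X) (f : X → ℝ) (C : ℝ)
    (hf : ∀ z, |f z| ≤ C) (y : X) (U : Ultrafilter ℕ) :
    ∃ l, Tendsto (fun n => birkhoffAverage ℝ α f n y) U (𝓝 l) := by
  have hmem : ∀ n, birkhoffAverage ℝ α f n y ∈ Set.Icc (-C) C := by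
    intro n
    have hC : 0 ≤ C := (abs_nonneg _).trans (hf y)
    rw [Set.mem_Icc, ← abs_le, birkhoffAverage, smul_eq_mul, abs_mul, abs_inv, Nat.abs_cast]
    rcases Nat.eq_zero_or_pos n with rfl | hn
    · simpa using hC
    rw [inv_mul_le_iff₀ (by exact_mod_cast hn)]
    calc |birkhoffSum α f n y| ≤ ∑ k ∈ Finset.range n, |f (α^[k] y)| :=
          Finset.abs_sum_le_sum_abs _ _
      _ ≤ ∑ k ∈ Finset.range n, C := Finset.sum_le_sum fun _ _ => hf _
      _ = n * C := by simp
  obtain ⟨l, -, hl⟩ := isCompact_Icc.ultrafilter_le_nhds (U.map fun n => birkhoffAverage ℝ α f n y)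
    (le_principal_iff.2 (mem_map.2 (Eventually.of_forall hmem)))
  exact ⟨l, hl⟩

open CompactlySupported in
/-- Every ultrafilter limit of the empirical measures of an orbit, tested against continuous
functions, is represented by an invariant regular probability measure. -/
lemma exists_invariantMeasure_tendsto_birkhoffAverage {X : Type*} [TopologicalSpace X]
    [CompactSpace X] [T2Space X] [MeasurableSpace X] [BorelSpace X] {α : X → X}
    (hα : Continuous α) (y : X) (U : Ultrafilter ℕ) (hU : (U : Filter ℕ) ≤ atTop) :
    ∃ μ ∈ invariantMeasures α, ∀ f : C(X, ℝ),
      Tendsto (fun n => birkhoffAverage ℝ α f n y) U (𝓝 (∫ z, f z ∂μ)) := by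
  have hlim : ∀ f : C_c(X, ℝ), ∃ l, Tendsto (fun n => birkhoffAverage ℝ α f n y) U (𝓝 l) := by
    intro f
    obtain ⟨C, hC⟩ := isCompact_univ.exists_bound_of_continuousOn f.continuous.continuousOn
    exact exists_tendsto_birkhoffAverage_ultrafilter α f C (fun z => hC z trivial) y U
  choose L hL using hlim
  let Λ : C_c(X, ℝ) →ₚ[ℝ] ℝ := PositiveLinearMap.mk₀
    { toFun := L
      map_add' := fun f g => by
        refine tendsto_nhds_unique (hL (f + g)) (((hL f).add (hL g)).congr fun n => ?_)
        simp [birkhoffAverage, birkhoffSum, Finset.sum_add_distrib, mul_add]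
      map_smul' := fun c f => by
        refine tendsto_nhds_unique (hL (c • f)) (((hL f).const_mul c).congr fun n => ?_)
        simp [birkhoffAverage, birkhoffSum, Finset.mul_sum, mul_left_comm] }
    (fun f hf => ge_of_tendsto' (hL f) fun n =>
      mul_nonneg (by positivity) (Finset.sum_nonneg fun k _ => hf _))
  have hint : ∀ f : C(X, ℝ), Tendsto (fun n => birkhoffAverage ℝ α f n y) U
      (𝓝 (∫ z, f z ∂(RealRMK.rieszMeasure Λ))) := by
    intro f
    have h := RealRMK.integral_rieszMeasure Λ (CompactlySupportedContinuousMap.continuousMapEquiv f)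
    have h' := hL (CompactlySupportedContinuousMap.continuousMapEquiv f)
    change Tendsto _ _ (𝓝 (Λ _)) at h'
    rw [← h] at h'
    exact h'
  set μ := RealRMK.rieszMeasure Λ
  have hone : μ.real Set.univ = 1 := by
    have h1 := hint 1
    simp only [ContinuousMap.one_apply, integral_const, smul_eq_mul, mul_one] at h1
    refine tendsto_nhds_unique h1 (tendsto_const_nhds.congr' ?_)
    filter_upwards [hU (eventually_gt_atTop 0)] with n hn
    have : (n : ℝ) ≠ 0 := by exact_mod_cast hn.ne'
    simp [birkhoffAverage, birkhoffSum, this]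
  have hprob : IsProbabilityMeasure μ := by
    constructor
    have h := ofReal_measureReal (μ := μ) (s := Set.univ)
    rw [← h, hone, ENNReal.ofReal_one]
  -- Integrals of continuous functions determine a measure only among regular ones, so the image
  -- measure must be regular too.
  have hreg : (μ.map α).Regular := by
    have : (μ.map α).InnerRegularCompactLTTop :=
      Measure.InnerRegularCompactLTTop.map_of_continuous hα
    infer_instance
  refine ⟨μ, ⟨hprob, inferInstance, hα.measurable, ?_⟩, hint⟩
  refine Measure.ext_of_integral_eq_on_compactlySupported fun f => ?_
  rw [integral_map (f := f) hα.aemeasurable f.continuous.aestronglyMeasurable]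
  have h1 := hint ((f : C(X, ℝ)).comp ⟨α, hα⟩)
  have h2 := hint (f : C(X, ℝ))
  refine tendsto_nhds_unique h1 ?_
  -- Moving the start from `y` to `α y` changes only two terms of the sum, an `O(1/n)` effect as `f`
  -- is bounded.
  have h3 : Tendsto (fun n => birkhoffAverage ℝ α f n (α y) - birkhoffAverage ℝ α f n y) U (𝓝 0) :=
    (tendsto_birkhoffAverage_apply_sub_birkhoffAverage' ℝ
      (isCompact_range f.continuous).isBounded α y).mono_left hU
  have h4 := h3.add h2
  rw [zero_add] at h4
  refine h4.congr fun n => ?_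
  change birkhoffAverage ℝ α f n (α y) - birkhoffAverage ℝ α f n y + birkhoffAverage ℝ α f n y = _
  rw [sub_add_cancel]
  simp only [birkhoffAverage, birkhoffSum, ContinuousMap.comp_apply]
  congr 1
  refine Finset.sum_congr rfl fun k _ => ?_
  change f _ = f _
  rw [← Function.iterate_succ_apply, Function.iterate_succ_apply']
  rfl

lemma empiricalMeasure_apply {X : Type*} [MeasurableSpace X] (α : X → X) (y : X) (n : ℕ)
    {V : Set X} (hV : MeasurableSet V) :
    empiricalMeasure α y n V = (n : ENNReal)⁻¹ * birkhoffSum α (V.indicator 1) n y := by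
  simp [empiricalMeasure, birkhoffSum, hV]

/-- If `g ≤ 1` and every orbit has a return time `n ∈ [1, N]` up to which the average of `g` is at
most `c`, then the orbit sums of `g` grow at rate at most `c`. -/
lemma birkhoffSum_le_of_bounded_times {X : Type*} {α : X → X} {g : X → ENNReal} {c : ENNReal}
    {N : ℕ} (hg : ∀ z, g z ≤ 1)
    (h : ∀ z, ∃ n, 0 < n ∧ n ≤ N ∧ birkhoffSum α g n z ≤ c * n) (M : ℕ) (y : X) :
    birkhoffSum α g M y ≤ c * M + N := by
  induction M using Nat.strong_induction_on generalizing y with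
  | _ M ih =>
    rcases le_total M N with hMN | hNM
    · calc birkhoffSum α g M y ≤ ∑ k ∈ Finset.range M, (1 : ENNReal) :=
            Finset.sum_le_sum fun _ _ => hg _
        _ = M := by simp
        _ ≤ N := by exact_mod_cast hMN
        _ ≤ _ := le_add_self
    -- Peel off one good block; the error `N` is paid only once, by the final piece.
    · obtain ⟨n, hn, hnN, hs⟩ := h y
      obtain ⟨m, rfl⟩ := Nat.exists_eq_add_of_le (hnN.trans hNM)
      rw [birkhoffSum_add]
      calc _ ≤ c * n + (c * m + N) := add_le_add hs (ih m (by omega) _)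
        _ = _ := by push_cast; ring

lemma lintegral_birkhoffSum {X : Type*} [MeasurableSpace X] {μ : Measure X} {α : X → X}
    (hα : MeasurePreserving α μ μ) {g : X → ENNReal} (hg : Measurable g) (n : ℕ) :
    ∫⁻ z, birkhoffSum α g n z ∂μ = n * ∫⁻ z, g z ∂μ := by
  simp only [birkhoffSum]
  have hm : ∀ k ∈ Finset.range n, Measurable fun z => g (α^[k] z) :=
    fun k _ => hg.comp (hα.iterate k).measurable
  rw [lintegral_finsetSum _ hm]
  simp [(hα.iterate _).lintegral_comp hg]

lemma lintegral_le_of_bounded_times {X : Type*} [MeasurableSpace X] {μ : Measure X}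
    [IsProbabilityMeasure μ] {α : X → X} (hα : MeasurePreserving α μ μ) {g : X → ENNReal}
    (hgm : Measurable g) {c : ENNReal} {N : ℕ} (hg : ∀ z, g z ≤ 1)
    (h : ∀ z, ∃ n, 0 < n ∧ n ≤ N ∧ birkhoffSum α g n z ≤ c * n) :
    ∫⁻ z, g z ∂μ ≤ c := by
  have hM : ∀ M : ℕ, 0 < M → ∫⁻ z, g z ∂μ ≤ c + N * (M : ENNReal)⁻¹ := by
    intro M hM
    have h1 : M * ∫⁻ z, g z ∂μ ≤ c * M + N := by
      rw [← lintegral_birkhoffSum hα hgm]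
      calc _ ≤ ∫⁻ _, (c * M + N) ∂μ :=
            lintegral_mono (birkhoffSum_le_of_bounded_times hg h M)
        _ = _ := by simp
    have hM0 : (M : ENNReal) ≠ 0 := by exact_mod_cast hM.ne'
    have hMt : (M : ENNReal) ≠ ⊤ := ENNReal.natCast_ne_top M
    calc ∫⁻ z, g z ∂μ = (M : ENNReal)⁻¹ * (M * ∫⁻ z, g z ∂μ) := by
          rw [← mul_assoc, ENNReal.inv_mul_cancel hM0 hMt, one_mul]
      _ ≤ (M : ENNReal)⁻¹ * (c * M + N) := by gcongr
      _ = c * ((M : ENNReal)⁻¹ * M) + N * (M : ENNReal)⁻¹ := by ring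
      _ = _ := by rw [ENNReal.inv_mul_cancel hM0 hMt, mul_one]
  have hlim : Tendsto (fun M : ℕ => c + N * (M : ENNReal)⁻¹) atTop (𝓝 (c + N * 0)) :=
    (ENNReal.Tendsto.const_mul ENNReal.tendsto_inv_nat_nhds_zero
      (Or.inr (ENNReal.natCast_ne_top N))).const_add c
  rw [mul_zero, add_zero] at hlim
  exact ge_of_tendsto hlim ((eventually_gt_atTop 0).mono hM)

/-- The good times may be unbounded in `z`. Points with none up to `N` form sets `B N` decreasing to
`∅`, so `μ (B N) → 0`. Deleting `B N` from `V` bounds the times by `N`: on `B N` the new indicator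
vanishes and `n = 1` serves. -/
lemma measure_le_of_exists_birkhoffSum_le {X : Type*} [MeasurableSpace X] {μ : Measure X}
    [IsProbabilityMeasure μ] {α : X → X} (hα : MeasurePreserving α μ μ) {V : Set X}
    (hV : MeasurableSet V) {c : ENNReal}
    (h : ∀ z, ∃ n, 0 < n ∧ birkhoffSum α (V.indicator 1) n z ≤ c * n) : μ V ≤ c := by
  set f : X → ENNReal := V.indicator 1 with hf
  have hfm : Measurable f := measurable_one.indicator hV
  have hSm : ∀ n, Measurable (birkhoffSum α f n) := fun n =>
    Finset.measurable_fun_sum _ fun k _ => hfm.comp (hα.iterate k).measurable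
  let B : ℕ → Set X := fun N => {z | ∀ n, 0 < n → n ≤ N → c * n < birkhoffSum α f n z}
  have hBm : ∀ N, MeasurableSet (B N) := fun N => by
    simp only [B, Set.ofPred_forall]
    exact MeasurableSet.iInter fun n => MeasurableSet.iInter fun _ => MeasurableSet.iInter fun _ =>
      measurableSet_lt measurable_const (hSm n)
  have hBanti : Antitone B := fun N M hNM z hz n hn hnN => hz n hn (hnN.trans hNM)
  have hBempty : ⋂ N, B N = ∅ := by
    refine Set.eq_empty_of_forall_notMem fun z hz => ?_
    obtain ⟨n, hn, hle⟩ := h z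
    exact (Set.mem_iInter.1 hz n n hn le_rfl).not_ge hle
  have hlim : Tendsto (fun N => c + μ (B N)) atTop (𝓝 c) := by
    have := tendsto_measure_iInter_atTop (μ := μ) (fun N => (hBm N).nullMeasurableSet) hBanti
      ⟨0, measure_ne_top _ _⟩
    rw [hBempty, measure_empty] at this
    simpa using this.const_add c
  refine ge_of_tendsto hlim ((eventually_gt_atTop 0).mono fun N hN => ?_)
  have key : ∫⁻ z, (V \ B N).indicator 1 z ∂μ ≤ c := by
    refine lintegral_le_of_bounded_times (N := N) hα
      (measurable_one.indicator (hV.diff (hBm N))) (fun z => Set.indicator_le_self' (by simp) z)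
      fun z => ?_
    by_cases hz : z ∈ B N
    · exact ⟨1, one_pos, hN, by simp [hz]⟩
    · simp only [B, Set.mem_ofPred_eq, not_forall, not_lt] at hz
      obtain ⟨n, hn, hnN, hle⟩ := hz
      refine ⟨n, hn, hnN, le_trans (Finset.sum_le_sum fun k _ => ?_) hle⟩
      exact Set.indicator_le_indicator_of_subset Set.sdiff_subset (fun _ => zero_le) _
  rw [lintegral_indicator_one (hV.diff (hBm N))] at key
  calc μ V ≤ μ ((V \ B N) ∪ B N) := measure_mono (by simp)
    _ ≤ μ (V \ B N) + μ (B N) := measure_union_le _ _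
    _ ≤ _ := by gcongr

/-- A set of positive measure for an invariant probability measure is visited with positive lower
density by some orbit. -/
lemma exists_liminf_empiricalMeasure_pos {X : Type*} [MeasurableSpace X] {μ : Measure X}
    [IsProbabilityMeasure μ] {α : X → X} (hα : MeasurePreserving α μ μ) {V : Set X}
    (hV : MeasurableSet V) (hpos : 0 < μ V) :
    ∃ y, 0 < liminf (fun n : ℕ => empiricalMeasure α y n V) atTop := by
  by_contra! hcon
  obtain ⟨c, hc0, hc⟩ := exists_between hpos
  refine hc.not_ge (measure_le_of_exists_birkhoffSum_le hα hV fun z => ?_)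
  have hfreq : ∃ᶠ n : ℕ in atTop, empiricalMeasure α z n V < c :=
    frequently_lt_of_liminf_lt (by isBoundedDefault) ((hcon z).trans_lt hc0)
  obtain ⟨n, hlt, hn⟩ := (hfreq.and_eventually (eventually_gt_atTop 0)).exists
  refine ⟨n, hn, ?_⟩
  rw [empiricalMeasure_apply α z n hV, ← ENNReal.div_eq_inv_mul] at hlt
  exact (ENNReal.div_le_iff (by exact_mod_cast hn.ne') (ENNReal.natCast_ne_top n)).1 hlt.le

lemma empiricalMeasure_le_ofReal_birkhoffAverage {X : Type*} [MeasurableSpace X] (α : X → X)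
    (y : X) (n : ℕ) {K : Set X} (hK : MeasurableSet K) {g : X → ℝ} (hg : ∀ z, 0 ≤ g z)
    (hgK : ∀ z ∈ K, g z = 1) :
    empiricalMeasure α y n K ≤ ENNReal.ofReal (birkhoffAverage ℝ α g n y) := by
  rw [empiricalMeasure_apply α y n hK]
  rcases Nat.eq_zero_or_pos n with rfl | hn
  · simp
  rw [birkhoffAverage, smul_eq_mul, ENNReal.ofReal_mul (by positivity),
    ENNReal.ofReal_inv_of_pos (by exact_mod_cast hn), ENNReal.ofReal_natCast]
  gcongr
  rw [birkhoffSum, birkhoffSum, ENNReal.ofReal_sum_of_nonneg fun _ _ => hg _]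
  refine Finset.sum_le_sum fun k _ => ?_
  by_cases hk : α^[k] y ∈ K
  · simp [hk, hgK _ hk]
  · simp [hk]

/-- If some orbit visits a closed set `K` with positive upper density, then every open set containing
`K` has positive measure for some invariant regular probability measure. -/
lemma exists_invariantMeasure_pos_of_limsup_pos {X : Type*} [TopologicalSpace X]
    [CompactSpace X] [T2Space X] [MeasurableSpace X] [BorelSpace X] {α : X → X}
    (hα : Continuous α) {K V : Set X} (hK : IsClosed K) (hV : IsOpen V) (hKV : K ⊆ V) {y : X}
    (hy : 0 < limsup (fun n : ℕ => empiricalMeasure α y n K) atTop) :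
    ∃ μ ∈ invariantMeasures α, 0 < μ V := by
  obtain ⟨c, hc0, hc⟩ := exists_between hy
  have hfreq : ∃ᶠ n : ℕ in atTop, c < empiricalMeasure α y n K :=
    frequently_lt_of_lt_limsup (by isBoundedDefault) hc
  have : (atTop ⊓ 𝓟 {n : ℕ | c < empiricalMeasure α y n K}).NeBot :=
    frequently_mem_iff_neBot.1 hfreq
  -- Every set of this ultrafilter meets the times of high frequency, so the lower bound `c`
  -- survives the limit.
  have hU := Ultrafilter.of_le (atTop ⊓ 𝓟 {n : ℕ | c < empiricalMeasure α y n K})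
  set U := Ultrafilter.of (atTop ⊓ 𝓟 {n : ℕ | c < empiricalMeasure α y n K})
  obtain ⟨μ, hμ, hint⟩ :=
    exists_invariantMeasure_tendsto_birkhoffAverage hα y U (hU.trans inf_le_left)
  refine ⟨μ, hμ, pos_iff_ne_zero.2 fun hzero => ?_⟩
  obtain ⟨g, hg0, hg1, hg⟩ := exists_continuous_zero_one_of_isClosed hV.isClosed_compl hK
    (Set.disjoint_compl_left_iff_subset.2 hKV)
  have hlim := hint g
  have hae : (g : X → ℝ) =ᵐ[μ] 0 := by
    have hVc : ∀ᵐ z ∂μ, z ∉ V := measure_eq_zero_iff_ae_notMem.1 hzero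
    filter_upwards [hVc] with z hz using hg0 hz
  rw [integral_eq_zero_of_ae hae] at hlim
  have hlim' := (ENNReal.continuous_ofReal.tendsto 0).comp hlim
  rw [ENNReal.ofReal_zero] at hlim'
  have hle : c ≤ 0 := by
    refine ge_of_tendsto hlim' ?_
    filter_upwards [hU (mem_inf_of_right (mem_principal_self _))] with n hn
    exact (le_of_lt hn).trans (empiricalMeasure_le_ofReal_birkhoffAverage α y n hK.measurableSet
      (fun z => (hg z).1) fun z hz => hg1 hz)
  exact hle.not_gt hc0

theorem mainTheorem11 {X : Type*} [TopologicalSpace X] [CompactSpace X] [T2Space X]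
    [MeasurableSpace X] [BorelSpace X] (α : X → X) (hα : Continuous α) (x : X) :
    List.TFAE [
      IsEssentialPoint α x,
      ∀ V ∈ 𝓝 x, ∃ y : X, 0 < liminf (fun n : ℕ => empiricalMeasure α y n V) atTop,
      ∀ V ∈ 𝓝 x, ∃ y : X, 0 < limsup (fun n : ℕ => empiricalMeasure α y n V) atTop] := by
  tfae_have 1 → 2 := by
    intro h V hV
    obtain ⟨μ, ⟨hprob, -, hinv⟩, hpos⟩ := h (interior V) (interior_mem_nhds.2 hV)
    obtain ⟨y, hy⟩ := exists_liminf_empiricalMeasure_pos hinv isOpen_interior.measurableSet hpos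
    exact ⟨y, hy.trans_le
      (liminf_le_liminf (Eventually.of_forall fun n => measure_mono interior_subset))⟩
  tfae_have 2 → 3 := by
    intro h V hV
    obtain ⟨y, hy⟩ := h V hV
    exact ⟨y, hy.trans_le liminf_le_limsup⟩
  tfae_have 3 → 1 := by
    intro h V hV
    obtain ⟨K, hKx, hK, hKV⟩ := exists_mem_nhds_isClosed_subset (interior_mem_nhds.2 hV)
    obtain ⟨y, hy⟩ := h K hKx
    obtain ⟨μ, hμ, hpos⟩ :=
      exists_invariantMeasure_pos_of_limsup_pos hα hK isOpen_interior hKV hy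
    exact ⟨μ, hμ, hpos.trans_le (measure_mono interior_subset)⟩
  tfae_finish
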